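/- For a positive integer $n$ put $m=m(n)=2^{2n}$ and let $(\mathbb{C}^{2^n})^{\odot m}\subseteq(\mathbb{C}^{2^n})^{\otimes m}=\mathcal H_1\otimes\cdots\otimes\mathcal H_m$ be the symmetric subspace, i.e. the linear span of the vectors $|\phi\rangle^{\otimes m}$ with $|\phi\rangle\in\mathbb{C}^{2^n}$. For a state $\sigma$ on $\mathcal H_1\otimes\mathcal H_2$, its entanglement of formation is $$E_f(\sigma)=\inf\sum_i p_i\,S\big(\mathrm{tr}_{\mathcal H_2}|\phi_i\rangle\langle\phi_i|\big),\qquad S(\tau)=-\mathrm{tr}\,\tau\log\tau ,$$ where $\log$ is the natural logarithm and the infimum is over all finite pure state ensembles $\{p_i,|\phi_i\rangle\}$ ($p_i\ge 0$, $\sum_i p_i=1$, $\|\phi_i\|=1$) with $\sum_i p_i|\phi_i\rangle\langle\phi_i|=\sigma$. Then there is a function $q:\mathbb{N}\to\mathbb{R}$, depending on $n$ only, such that (a) $q$ is exponential: there are real numbers $a>1$ and $b$ with $a^n\le q(n)\le b^n$ for all sufficiently large $n$; (b) $1/q(n)=O(n\,2^{-n})$ as $n\to\infty$; (c) for every $n\ge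 1$ we have $q(n)>0$, and for every density matrix $\rho$ on $(\mathbb{C}^{2^n})^{\otimes m}$ supported on $(\mathbb{C}^{2^n})^{\odot m}$ (that is, whose range is contained in it), the reduced state $\rho|_{\mathcal H_1\otimes\mathcal H_2}$ on the first two sites satisfies $$E_f\big(\rho|_{\mathcal H_1\otimes\mathcal H_2}\big)\le\frac1{q(n)} .$$ -/

import Mathlib

open Filter Asymptotics
open scoped Topology ComplexOrder

noncomputable section

namespace QuantumEnt

/-- A density matrix on `ℂ^ι`: positive semidefinite of trace one. -/
def IsDensity {ι : Type*} [Fintype ι] (ρ : Matrix ι ι ℂ) : Prop :=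
  ρ.PosSemidef ∧ ρ.trace = 1

/-- A unit vector of `ℂ^ι` for the Euclidean norm. -/
def IsUnitVec {ι : Type*} [Fintype ι] (φ : ι → ℂ) : Prop :=
  ∑ i, ‖φ i‖ ^ 2 = 1

/-- The rank one operator `|φ⟩⟨φ|`. -/
def ketbra {ι : Type*} (φ : ι → ℂ) : Matrix ι ι ℂ :=
  Matrix.vecMulVec φ (star φ)

/-- The reduced matrix on the first factor of `ℂ^α ⊗ ℂ^β` (partial trace over the second). -/
def reduceFst {α β : Type*} [Fintype β] (M : Matrix (α × β) (α × β) ℂ) : Matrix α α ℂ :=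
  Matrix.of fun i j => ∑ b, M (i, b) (j, b)

/-- The von Neumann entropy `-tr ρ log ρ` (natural logarithm, `0 log 0 = 0`); the operator
`log ρ` is given by the continuous functional calculus. -/
def entropy {ι : Type*} [Fintype ι] [DecidableEq ι] (ρ : Matrix ι ι ℂ) : ℝ :=
  -(ρ * cfc Real.log ρ).trace.re

/-- The (finite) family `(p i, φ i)` is a pure state ensemble for the bipartite matrix `ρ`:
the `p i` are probabilities, the `φ i` are unit vectors, and `∑ i, p i |φ i⟩⟨φ i| = ρ`. -/
structure IsPureEnsemble {ι : Type*} [Fintype ι] {N : ℕ} (ρ : Matrix ι ι ℂ)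
    (p : Fin N → ℝ) (φ : Fin N → ι → ℂ) : Prop where
  nonneg : ∀ i, 0 ≤ p i
  sum_eq_one : ∑ i, p i = 1
  unit : ∀ i, IsUnitVec (φ i)
  decomp : ∑ i, (p i : ℂ) • ketbra (φ i) = ρ

/-- The entanglement of formation of a state on `ℂ^α ⊗ ℂ^β`: the infimum, over all finite pure
state ensembles of `ρ`, of the average entropy of the reduced states on the first factor.
(For a density matrix `ρ` ensembles exist and the averages are nonnegative, so this is a
genuine infimum.) -/
def eof {α β : Type*} [Fintype α] [Fintype β] [DecidableEq α]
    (ρ : Matrix (α × β) (α × β) ℂ) : ℝ :=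
  sInf {s : ℝ | ∃ (N : ℕ) (p : Fin N → ℝ) (φ : Fin N → α × β → ℂ),
    IsPureEnsemble ρ p φ ∧ s = ∑ i, p i * entropy (reduceFst (ketbra (φ i)))}

/-- The vector `φ^{⊗ m}` of `(ℂ^α)^{⊗ m}`, the latter with the product basis indexed by
`Fin m → α`. -/
def tensorPow {α : Type*} (m : ℕ) (φ : α → ℂ) : (Fin m → α) → ℂ :=
  fun x => ∏ t, φ (x t)

/-- The symmetric subspace of `(ℂ^α)^{⊗ m}`, spanned by the vectors `φ^{⊗ m}`. -/
def symSubspace (α : Type*) (m : ℕ) : Submodule ℂ ((Fin m → α) → ℂ) :=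
  Submodule.span ℂ (Set.range (tensorPow (α := α) m))

/-- `ρ` is a state on `(ℂ^α)^{⊗ m}` supported on the symmetric subspace: a density matrix
whose range lies in that subspace. -/
def IsSymState {α : Type*} [Fintype α] {m : ℕ} (ρ : Matrix (Fin m → α) (Fin m → α) ℂ) : Prop :=
  IsDensity ρ ∧ ∀ v, ρ.mulVec v ∈ symSubspace α m

/-- The configuration of `m` sites whose values at the first two sites are `p.1`, `p.2` and whose
values at the remaining `m - 2` sites are given by `r`. -/
def joinSites {α : Type*} {m : ℕ} (p : α × α) (r : Fin (m - 2) → α) : Fin m → α :=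
  fun t => if _h0 : t.val = 0 then p.1 else if _h1 : t.val = 1 then p.2 else
    r ⟨t.val - 2, by omega⟩

/-- The reduced matrix on the first two of `m ≥ 2` sites (partial trace over all others). -/
def reduceTwoSites {α : Type*} [Fintype α] {m : ℕ} (ρ : Matrix (Fin m → α) (Fin m → α) ℂ) :
    Matrix (α × α) (α × α) ℂ :=
  Matrix.of fun p q => ∑ r : Fin (m - 2) → α, ρ (joinSites p r) (joinSites q r)

/-- `q` grows exponentially: `a ^ n ≤ q n ≤ b ^ n` for all large `n`, with `1 < a`. -/
def IsExponential (q : ℕ → ℝ) : Prop :=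
  ∃ a b : ℝ, 1 < a ∧ ∀ᶠ n in atTop, a ^ n ≤ q n ∧ q n ≤ b ^ n

end QuantumEnt

end

namespace QuantumEnt

/-! Put `d = 2 ^ n`, `k = m - 2`. Measuring the last `k` sites of a symmetric state with Gaussian
coherent vectors `φ^{⊗ k}`, whose projectors average to `k!` times the projector onto the symmetric
subspace, decomposes the two-site state into conditional vectors `ψ`. By symmetry `ψ` points mostly
along `φ ⊗ φ`: its overlap with that product is, up to weights, the overlap of the full vector with
`φ^{⊗ m}`.

Wick's theorem computes the average squared overlap. The normalization `1/‖φ‖⁴` is bounded below by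
a tangent line in `‖φ‖²`, so only moments of degree `m` and `m + 1` enter, and the mean fidelity is
at least `m(m-1)/(m+d)²` (`eof_reduceTwoSites_le`). A bound on entropy that is affine in the
fidelity (`entropy_reduceFst_ketbra_le`) can be averaged over the ensemble. For `m = d²` the mean
infidelity is at most `2/(d+1)`, and the logarithmic factor is `O(n)`.

Ensembles must be finite, so the Gaussian law is replaced by a finite quadrature with the same low
moments (`exists_wick_frame`). -/

/-! ### Finite quadratures for the exponential and complex Gaussian laws. -/

/-- By Carathéodory the hull is a finite union of continuous images of compact sets: simplex weights
times tuples of at most `finrank + 1` points. -/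
theorem isCompact_convexHull_of_finiteDimensional {E : Type*} [NormedAddCommGroup E]
    [NormedSpace ℝ E] [FiniteDimensional ℝ E] {s : Set E} (hs : IsCompact s) :
    IsCompact (convexHull ℝ s) := by
  let F : (n : ℕ) → (Fin n → ℝ) × (Fin n → E) → E := fun n p => ∑ i, p.1 i • p.2 i
  have hF : ∀ n, IsCompact (F n '' (stdSimplex ℝ (Fin n) ×ˢ Set.univ.pi fun _ => s)) := fun n =>
    ((isCompact_stdSimplex ℝ (Fin n)).prod (isCompact_univ_pi fun _ => hs)).image (by
      simp only [F]; fun_prop)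
  have key : convexHull ℝ s = ⋃ n ∈ Set.Iic (Module.finrank ℝ E + 1),
      F n '' (stdSimplex ℝ (Fin n) ×ˢ Set.univ.pi fun _ => s) := by
    apply Set.Subset.antisymm
    · intro x hx
      obtain ⟨ι, _, z, w, hz, hind, hw, hw1, rfl⟩ := eq_pos_convex_span_of_mem_convexHull hx
      have hcard : Fintype.card ι ≤ Module.finrank ℝ E + 1 :=
        hind.card_le_finrank_succ.trans
          (Nat.add_le_add_right (Submodule.finrank_le _) 1)
      let e := (Fintype.equivFin ι).symm
      refine Set.mem_biUnion hcard ⟨(w ∘ e, z ∘ e), ⟨⟨fun i => (hw _).le, ?_⟩, ?_⟩, ?_⟩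
      · exact (e.sum_comp w).trans hw1
      · exact fun i _ => hz ⟨_, rfl⟩
      · exact e.sum_comp fun i => w i • z i
    · refine Set.iUnion₂_subset fun n _ => ?_
      rintro _ ⟨⟨w, z⟩, ⟨hw, hz⟩, rfl⟩
      exact (convex_convexHull ℝ s).sum_mem (fun i _ => hw.1 i) hw.2
        fun i _ => subset_convexHull ℝ s (hz i trivial)
  rw [key]
  exact (Set.finite_Iic _).isCompact_biUnion fun n _ => hF n

theorem integrableOn_pow_mul_exp_neg (k : ℕ) :
    MeasureTheory.IntegrableOn (fun x : ℝ => Real.exp (-x) * x ^ k) (Set.Ioi 0) := by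
  have := Real.GammaIntegral_convergent (s := (k : ℝ) + 1) (by positivity)
  simpa using this

theorem integral_pow_mul_exp_neg (k : ℕ) :
    ∫ x in Set.Ioi (0 : ℝ), Real.exp (-x) * x ^ k = (k.factorial : ℝ) := by
  have := Real.Gamma_eq_integral (s := (k : ℝ) + 1) (by positivity)
  rw [Real.Gamma_nat_eq_factorial] at this
  simpa using this.symm

/-- A polynomial that is nonpositive on the positive half-line has nonpositive mean
for the exponential law. -/
theorem sum_mul_factorial_nonpos {n : ℕ} (c : Fin n → ℝ)
    (hc : ∀ t : ℝ, 0 < t → ∑ k, c k * t ^ (k : ℕ) ≤ 0) :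
    ∑ k, c k * ((k : ℕ).factorial : ℝ) ≤ 0 := by
  have h1 : ∑ k, c k * ((k : ℕ).factorial : ℝ) =
      ∫ x in Set.Ioi (0 : ℝ), ∑ k, c k * (Real.exp (-x) * x ^ (k : ℕ)) := by
    rw [MeasureTheory.integral_finsetSum _
      fun (k : Fin n) _ => (integrableOn_pow_mul_exp_neg (k : ℕ)).const_mul (c k)]
    simp_rw [MeasureTheory.integral_const_mul, integral_pow_mul_exp_neg]
  rw [h1]
  refine MeasureTheory.setIntegral_nonpos measurableSet_Ioi fun x hx => ?_
  have : ∑ k, c k * (Real.exp (-x) * x ^ (k : ℕ)) =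
      Real.exp (-x) * ∑ k, c k * x ^ (k : ℕ) := by
    rw [Finset.mul_sum]; exact Finset.sum_congr rfl fun k _ => by ring
  rw [this]
  exact mul_nonpos_of_nonneg_of_nonpos (Real.exp_pos _).le (hc x hx)

/-- A finitely supported measure on the half-line with the first moments of the exponential law. -/
theorem exists_exponential_quadrature (M : ℕ) :
    ∃ (N : ℕ) (w t : Fin N → ℝ), (∀ j, 0 ≤ w j) ∧ (∀ j, 0 ≤ t j) ∧
      ∀ k ≤ M, ∑ j, w j * t j ^ k = (k.factorial : ℝ) := by
  -- The moment curve in the coordinate `s = t / (1 + t)`, rescaled by `(1 + t) ^ (M + 1)`; adding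
  -- `s = 1` (that is, `t = ∞`) makes it compact. The degree is `M + 1` so that this extra point
  -- affects only the top moment, which is not claimed.
  let γ : ℝ → Fin (M + 2) → ℝ := fun s k => s ^ (k : ℕ) * (1 - s) ^ (M + 1 - k)
  have hγ : Continuous γ := by simp only [γ]; fun_prop
  let b : Fin (M + 2) → ℝ := fun k => ((M + 1).choose k : ℝ)
  let Z : ℝ := ∑ k, b k * ((k : ℕ).factorial : ℝ)
  have hZ : 0 < Z := by
    refine Finset.sum_pos (fun k _ => ?_) Finset.univ_nonempty
    have : 0 < (M + 1).choose k := Nat.choose_pos (by have := k.2; omega)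
    have := Nat.factorial_pos (k : ℕ)
    simp only [b]
    positivity
  let c : Fin (M + 2) → ℝ := fun k => ((k : ℕ).factorial : ℝ) / Z
  have hmem : c ∈ convexHull ℝ (γ '' Set.Icc 0 1) := by
    -- A separating functional would give a polynomial that is nonpositive on the positive half-line
    -- but has positive exponential mean.
    by_contra hc
    obtain ⟨f, u, hf, hu⟩ := geometric_hahn_banach_closed_point (convex_convexHull ℝ _)
      (isCompact_convexHull_of_finiteDimensional (isCompact_Icc.image hγ)).isClosed hc
    have hfs : ∀ v : Fin (M + 2) → ℝ, f v = ∑ k, v k * f (Pi.single k 1) := fun v => by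
      conv_lhs => rw [pi_eq_sum_univ' v]
      simp
    have hpoly := sum_mul_factorial_nonpos (fun k => f (Pi.single k 1) - u * b k) (fun t ht => by
      have h1 : (0 : ℝ) < 1 + t := by linarith
      have hs : t / (1 + t) ∈ Set.Icc (0 : ℝ) 1 :=
        ⟨by positivity, by rw [div_le_one h1]; linarith⟩
      have h2 := hf _ (subset_convexHull ℝ _ ⟨_, hs, rfl⟩)
      have h3 : ∀ k : Fin (M + 2), (1 + t) ^ (M + 1) * γ (t / (1 + t)) k = t ^ (k : ℕ) := by
        intro k
        have hk : (k : ℕ) ≤ M + 1 := by have := k.2; omega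
        have : 1 - t / (1 + t) = 1 / (1 + t) := by field_simp; ring
        simp only [γ, this]
        rw [← Nat.add_sub_cancel' hk, pow_add]
        simp only [Nat.add_sub_cancel_left, div_pow, one_pow]
        field_simp
      have h4 : (1 + t) ^ (M + 1) = ∑ k : Fin (M + 2), b k * t ^ (k : ℕ) := by
        rw [add_comm, add_pow, Finset.sum_range]
        exact Finset.sum_congr rfl fun k _ => by simp [b, mul_comm]
      have h5 : (1 + t) ^ (M + 1) * f (γ (t / (1 + t))) =
          ∑ k : Fin (M + 2), f (Pi.single k 1) * t ^ (k : ℕ) := by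
        rw [hfs, Finset.mul_sum]
        exact Finset.sum_congr rfl fun k _ => by rw [← h3 k]; ring
      have h6 : ∑ k : Fin (M + 2), (f (Pi.single k 1) - u * b k) * t ^ (k : ℕ) =
          (1 + t) ^ (M + 1) * (f (γ (t / (1 + t))) - u) := by
        rw [mul_sub, h5, h4, Finset.sum_mul, ← Finset.sum_sub_distrib]
        exact Finset.sum_congr rfl fun k _ => by ring
      rw [h6]
      exact mul_nonpos_of_nonneg_of_nonpos (by positivity) (by linarith))
    have h7 : ∑ k : Fin (M + 2), (f (Pi.single k 1) - u * b k) * ((k : ℕ).factorial : ℝ) =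
        Z * (f c - u) := by
      rw [hfs, mul_sub, Finset.mul_sum, Finset.sum_mul, ← Finset.sum_sub_distrib]
      refine Finset.sum_congr rfl fun k _ => ?_
      simp only [c]
      field_simp
    rw [h7] at hpoly
    nlinarith
  obtain ⟨ι, _, w, z, hw, -, hz, hc⟩ := mem_convexHull_iff_exists_fintype.1 hmem
  choose s hs hsz using hz
  let e := (Fintype.equivFin ι).symm
  refine ⟨Fintype.card ι, (fun i => Z * w i * (1 - s i) ^ (M + 1)) ∘ e,
    (fun i => s i / (1 - s i)) ∘ e, fun j => ?_, fun j => ?_, fun k hk => ?_⟩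
  · have := (hs (e j)).2
    exact mul_nonneg (mul_nonneg hZ.le (hw _)) (pow_nonneg (by linarith) _)
  · have := hs (e j)
    exact div_nonneg this.1 (by linarith [this.2])
  · have h1 := e.sum_comp fun i => (Z * w i * (1 - s i) ^ (M + 1)) * (s i / (1 - s i)) ^ k
    refine h1.trans ?_
    have h2 := congrFun hc ⟨k, by omega⟩
    simp only [c, Finset.sum_apply, Pi.smul_apply, smul_eq_mul, eq_div_iff hZ.ne'] at h2
    rw [← h2, Finset.sum_mul]
    refine Finset.sum_congr rfl fun i _ => ?_
    rw [← hsz i]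
    simp only [γ]
    -- At `s i = 1` the node is `1 / 0 = 0` with weight `0`, and the curve also vanishes there in
    -- every degree `k ≤ M`.
    rcases eq_or_ne (1 - s i) 0 with h0 | h0
    · rw [h0, zero_pow (by omega : M + 1 ≠ 0), zero_pow (by omega : M + 1 - k ≠ 0)]; ring
    · have : M + 1 = k + (M + 1 - k) := by omega
      rw [this, pow_add, Nat.add_sub_cancel_left, div_pow]
      field_simp

/-- A finitely supported measure on `ℂ` with the first mixed moments of the standard complex
Gaussian law. -/
theorem exists_gaussian_quadrature (M : ℕ) :
    ∃ (C : Type) (_ : Fintype C) (w : C → ℝ) (z : C → ℂ), (∀ c, 0 ≤ w c) ∧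
      ∀ a b : ℕ, a ≤ M → b ≤ M →
        ∑ c, (w c : ℂ) * (z c ^ a * star (z c) ^ b) = if a = b then (a.factorial : ℂ) else 0 := by
  obtain ⟨N, w, t, hw, ht, hmom⟩ := exists_exponential_quadrature M
  -- For a Gaussian `z`, `|z|²` is exponential and the phase is uniform and independent. Roots of
  -- unity of order `M + 1` suffice for the phase, since distinct exponents `a, b ≤ M` stay distinct
  -- modulo `M + 1`.
  let ω : ℂ := Complex.exp (2 * Real.pi * Complex.I / ((M + 1 : ℕ) : ℂ))
  have hω : IsPrimitiveRoot ω (M + 1) := Complex.isPrimitiveRoot_exp _ (by omega)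
  have hn : ‖ω‖ = 1 := hω.norm'_eq_one (by omega)
  have hstar : star ω = ω⁻¹ := by
    rw [Complex.inv_def, Complex.normSq_eq_norm_sq, hn]; simp
  refine ⟨Fin N × Fin (M + 1), inferInstance, fun c => w c.1 / (M + 1),
    fun c => (Real.sqrt (t c.1) : ℂ) * ω ^ (c.2 : ℕ), fun c => by have := hw c.1; positivity,
    fun a b ha hb => ?_⟩
  have hM : ((M : ℂ) + 1) ≠ 0 := by exact_mod_cast Nat.succ_ne_zero M
  have hphase : ∑ l : Fin (M + 1), (ω ^ a * star ω ^ b) ^ (l : ℕ) =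
      if a = b then (M + 1 : ℂ) else 0 := by
    have hω0 : ω ≠ 0 := hω.ne_zero (by omega)
    rw [hstar]
    split_ifs with h
    · subst h
      rw [← mul_pow, mul_inv_cancel₀ hω0]
      simp
    · have h1 : ω ^ a * ω⁻¹ ^ b ≠ 1 := fun h' => h <| by
        rw [inv_pow, mul_inv_eq_one₀ (pow_ne_zero _ hω0)] at h'
        exact hω.pow_inj (by omega) (by omega) h'
      rw [← Finset.sum_range fun l => (ω ^ a * ω⁻¹ ^ b) ^ l]
      have h2 : (ω ^ a * ω⁻¹ ^ b) ^ (M + 1) = 1 := by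
        rw [mul_pow, ← pow_mul, ← pow_mul, mul_comm a, mul_comm b, pow_mul, pow_mul, inv_pow ω,
          hω.pow_eq_one]
        simp
      have h3 := mul_neg_geom_sum (ω ^ a * ω⁻¹ ^ b) (M + 1)
      rw [h2, sub_self, mul_eq_zero, sub_eq_zero] at h3
      exact h3.resolve_left (Ne.symm h1)
  rw [Fintype.sum_prod_type]
  have h1 : ∀ j, ∑ l : Fin (M + 1), ((w j / (M + 1) : ℝ) : ℂ) *
      (((Real.sqrt (t j) : ℂ) * ω ^ (l : ℕ)) ^ a * star ((Real.sqrt (t j) : ℂ) * ω ^ (l : ℕ)) ^ b) =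
      (w j / (M + 1)) * (Real.sqrt (t j) : ℂ) ^ (a + b) * if a = b then (M + 1 : ℂ) else 0 := by
    intro j
    rw [← hphase, Finset.mul_sum]
    refine Finset.sum_congr rfl fun l _ => ?_
    simp only [star_mul', star_pow, Complex.star_def, Complex.conj_ofReal]
    push_cast
    ring
  simp only [h1]
  split_ifs with h
  · subst h
    have hm := congrArg (fun x : ℝ => (x : ℂ)) (hmom a ha)
    push_cast at hm
    rw [← hm]
    refine Finset.sum_congr rfl fun j _ => ?_
    rw [← two_mul, pow_mul, ← Complex.ofReal_pow (Real.sqrt (t j)), Real.sq_sqrt (ht j)]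
    field_simp
  · simp

/-! ### Wick's theorem and the coherent resolution of the symmetric subspace. -/

section Wick

universe u

variable {α : Type u} [DecidableEq α]

/-- The number of permutations of the sites that carry the configuration `r` to `r'`. -/
def permCount {k : ℕ} (r r' : Fin k → α) : ℕ :=
  Fintype.card {π : Equiv.Perm (Fin k) // r ∘ π = r'}

/-- The occupation numbers of a configuration. -/
def occupation {k : ℕ} (r : Fin k → α) (a : α) : ℕ :=
  Fintype.card {t // r t = a}

theorem occupation_comp_perm {k : ℕ} (r : Fin k → α) (π : Equiv.Perm (Fin k)) :
    occupation (r ∘ π) = occupation r := by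
  funext a
  exact Fintype.card_congr (π.subtypeEquiv fun t => by simp)

theorem exists_perm_of_occupation_eq {k : ℕ} {r r' : Fin k → α}
    (h : occupation r = occupation r') : ∃ π : Equiv.Perm (Fin k), r ∘ π = r' := by
  have e : ∀ a, {t // r' t = a} ≃ {t // r t = a} := fun a =>
    Fintype.equivOfCardEq (congrFun h a).symm
  refine ⟨(Equiv.sigmaFiberEquiv r').symm.trans
    ((Equiv.sigmaCongrRight e).trans (Equiv.sigmaFiberEquiv r)), funext fun t => ?_⟩
  exact (e (r' t) ⟨t, rfl⟩).2

theorem occupation_le {k : ℕ} (r : Fin k → α) (a : α) : occupation r a ≤ k := by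
  simpa [occupation] using Fintype.card_subtype_le fun t => r t = a

variable [Fintype α]

/-- When nonempty, the set of such permutations is a coset of the stabilizer of `r`, a product of
symmetric groups. This matches the product of the one-variable Gaussian moments. -/
theorem permCount_eq {k : ℕ} (r r' : Fin k → α) :
    permCount r r' =
      if occupation r = occupation r' then ∏ a, (occupation r a).factorial else 0 := by
  split_ifs with h
  · obtain ⟨σ, rfl⟩ := exists_perm_of_occupation_eq h
    refine Eq.trans (Fintype.card_congr ?_) (DomMulAct.stabilizer_card r)
    refine (Equiv.mulRight σ⁻¹).subtypeEquiv fun π => ?_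
    constructor
    · intro h
      funext t
      have := congrFun h (σ⁻¹ t)
      simpa using this
    · intro h
      funext t
      have := congrFun h (σ t)
      simpa using this
  · refine Fintype.card_eq_zero_iff.2 ⟨fun π => h ?_⟩
    rw [← π.2, occupation_comp_perm]

theorem tensorPow_eq_prod_occupation {k : ℕ} (φ : α → ℂ) (r : Fin k → α) :
    tensorPow k φ r = ∏ a, φ a ^ occupation r a := by
  simp only [tensorPow, occupation, Fintype.card_subtype]
  rw [← Finset.prod_fiberwise Finset.univ r fun t => φ (r t)]
  refine Finset.prod_congr rfl fun a _ => ?_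
  rw [Finset.prod_congr rfl fun t ht => by rw [(Finset.mem_filter.1 ht).2], Finset.prod_const]

theorem sum_occupation {k : ℕ} (r : Fin k → α) : ∑ a, occupation r a = k := by
  simp only [occupation, Fintype.card_subtype]
  have := Finset.card_eq_sum_card_fiberwise (f := r) (s := Finset.univ) (t := Finset.univ)
    (fun _ _ => by simp)
  simpa using this.symm

/-- A finite weighted family of vectors of `ℂ^α` that obeys Wick's theorem up to degree `M`. -/
theorem exists_wick_frame (α : Type u) [Fintype α] [DecidableEq α] (M : ℕ) :
    ∃ (I : Type u) (_ : Fintype I) (w : I → ℝ) (φ : I → α → ℂ), (∀ i, 0 ≤ w i) ∧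
      (∀ k ≤ M, ∀ r r' : Fin k → α,
        ∑ i, (w i : ℂ) * (tensorPow k (φ i) r * star (tensorPow k (φ i) r')) =
          permCount r r') ∧
      (∀ k < M, ∀ r r' : Fin k → α,
        ∑ i, ((w i * ∑ a, ‖φ i a‖ ^ 2 : ℝ) : ℂ) *
            (tensorPow k (φ i) r * star (tensorPow k (φ i) r')) =
          ((k + Fintype.card α : ℕ) : ℂ) * permCount r r') := by
  obtain ⟨C, _, w, z, hw, hmom⟩ := exists_gaussian_quadrature M
  have key : ∀ A B : α → ℕ, (∀ a, A a ≤ M) → (∀ a, B a ≤ M) →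
      ∑ i : α → C, ((∏ a, w (i a) : ℝ) : ℂ) *
        ((∏ a, z (i a) ^ A a) * star (∏ a, z (i a) ^ B a)) =
        if A = B then ∏ a, ((A a).factorial : ℂ) else 0 := by
    intro A B hA hB
    have h1 : ∀ i : α → C, ((∏ a, w (i a) : ℝ) : ℂ) *
        ((∏ a, z (i a) ^ A a) * star (∏ a, z (i a) ^ B a)) =
        ∏ a, ((w (i a) : ℂ) * (z (i a) ^ A a * star (z (i a)) ^ B a)) := by
      intro i
      simp only [Finset.prod_mul_distrib, star_prod, star_pow, Complex.ofReal_prod]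
    simp only [h1]
    rw [← Fintype.prod_sum fun a c => (w c : ℂ) * (z c ^ A a * star (z c) ^ B a)]
    simp only [hmom _ _ (hA _) (hB _)]
    split_ifs with h
    · subst h; simp
    · obtain ⟨a, ha⟩ := Function.ne_iff.1 h
      exact Finset.prod_eq_zero (Finset.mem_univ a) (if_neg ha)
  refine ⟨α → C, inferInstance, fun i => ∏ a, w (i a), fun i a => z (i a),
    fun i => Finset.prod_nonneg fun a _ => hw _, fun k hk r r' => ?_, fun k hk r r' => ?_⟩
  · simp only [tensorPow_eq_prod_occupation]
    rw [key _ _ (fun a => (occupation_le r a).trans hk) (fun a => (occupation_le r' a).trans hk),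
      permCount_eq]
    push_cast
    rfl
  -- Each factor `‖z (i a)‖ ^ 2` raises both occupation numbers at `a` by one, which multiplies the
  -- moment by `occupation r a + 1`; summing over `a` gives `k + card α`. The raised degree is why
  -- `k < M` is required.
  · have h1 : ∀ i : α → C, (((∏ a, w (i a)) * ∑ a, ‖z (i a)‖ ^ 2 : ℝ) : ℂ) *
        (tensorPow k (fun a => z (i a)) r * star (tensorPow k (fun a => z (i a)) r')) =
        ∑ a, ((∏ a, w (i a) : ℝ) : ℂ) *
          ((∏ b, z (i b) ^ (occupation r b + (Pi.single a 1 : α → ℕ) b)) *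
            star (∏ b, z (i b) ^ (occupation r' b + (Pi.single a 1 : α → ℕ) b))) := by
      intro i
      simp only [tensorPow_eq_prod_occupation]
      push_cast
      rw [Finset.mul_sum, Finset.sum_mul]
      refine Finset.sum_congr rfl fun a _ => ?_
      have h2 : ∏ b, z (i b) ^ ((Pi.single a 1 : α → ℕ) b) = z (i a) := by
        rw [Finset.prod_eq_single a] <;> simp +contextual
      simp only [pow_add, Finset.prod_mul_distrib, h2, star_mul']
      rw [← Complex.mul_conj', ← Complex.star_def]
      ring
    simp only [h1]
    rw [Finset.sum_comm]
    have h3 : ∀ (s : Fin k → α) (a b : α), occupation s b + (Pi.single a 1 : α → ℕ) b ≤ M := by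
      intro s a b
      have h4 : (Pi.single a 1 : α → ℕ) b ≤ 1 := by
        rw [Pi.single_apply]; split_ifs <;> simp
      have := occupation_le s b
      omega
    simp only [key (fun b => occupation r b + (Pi.single _ 1 : α → ℕ) b)
      (fun b => occupation r' b + (Pi.single _ 1 : α → ℕ) b) (h3 r _) (h3 r' _)]
    rw [permCount_eq]
    by_cases h : occupation r = occupation r'
    · simp only [h, if_true]
      have h5 : ∀ a, ∏ b, ((occupation r' b + (Pi.single a 1 : α → ℕ) b).factorial : ℂ) =
          (occupation r' a + 1) * ∏ b, ((occupation r' b).factorial : ℂ) := by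
        intro a
        rw [← Finset.mul_prod_erase _ _ (Finset.mem_univ a),
          ← Finset.mul_prod_erase (a := a) _ (fun b => ((occupation r' b).factorial : ℂ))
            (Finset.mem_univ a),
          Finset.prod_congr rfl fun b hb => by
            rw [Pi.single_eq_of_ne (Finset.ne_of_mem_erase hb), add_zero]]
        simp only [Pi.single_eq_same, Nat.factorial_succ]
        push_cast
        ring
      simp only [h5]
      rw [← Finset.sum_mul, Finset.sum_add_distrib]
      have h6 := congrArg (fun n : ℕ => (n : ℂ)) (sum_occupation r')
      push_cast at h6 ⊢
      rw [h6]
      simp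
    · have h6 : ∀ a, ¬ (fun b => occupation r b + (Pi.single a 1 : α → ℕ) b) =
          fun b => occupation r' b + (Pi.single a 1 : α → ℕ) b := fun a h' =>
        h (funext fun b => by have := congrFun h' b; simpa using this)
      simp [h, h6]

/-- The value of `⟨φ|^{⊗ k}` on a vector of `(ℂ^α)^{⊗ k}`. -/
def tensorPowInner {k : ℕ} (φ : α → ℂ) (u : (Fin k → α) → ℂ) : ℂ :=
  ∑ r, star (tensorPow k φ r) * u r

theorem sum_permCount_mul {k : ℕ} (u : (Fin k → α) → ℂ)
    (hu : ∀ (π : Equiv.Perm (Fin k)) r, u (r ∘ π) = u r) (r : Fin k → α) :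
    ∑ r', (permCount r r' : ℂ) * u r' = (k.factorial : ℂ) * u r := by
  have h1 : ∀ r', (permCount r r' : ℂ) = ∑ π : Equiv.Perm (Fin k), if r ∘ π = r' then 1 else 0 := by
    intro r'
    simp [permCount, Fintype.card_subtype]
  simp only [h1, Finset.sum_mul]
  rw [Finset.sum_comm]
  simp [hu, Fintype.card_perm]

/-- The hypothesis says that the frame operator is `κ` times the sum of all site permutations, which
acts on a symmetric vector as the scalar `κ * k!`. -/
theorem sum_tensorPowInner_mul_star {I : Type*} [Fintype I] {k : ℕ} (w : I → ℝ) (φ : I → α → ℂ)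
    (κ : ℂ) (h : ∀ r r' : Fin k → α,
      ∑ i, (w i : ℂ) * (tensorPow k (φ i) r * star (tensorPow k (φ i) r')) = κ * permCount r r')
    (u u' : (Fin k → α) → ℂ) (hu : ∀ (π : Equiv.Perm (Fin k)) r, u (r ∘ π) = u r) :
    ∑ i, (w i : ℂ) * (tensorPowInner (φ i) u * star (tensorPowInner (φ i) u')) =
      κ * k.factorial * ∑ r, u r * star (u' r) := by
  calc ∑ i, (w i : ℂ) * (tensorPowInner (φ i) u * star (tensorPowInner (φ i) u'))
      = ∑ i, ∑ r', ∑ r, (w i : ℂ) * (tensorPow k (φ i) r' * star (tensorPow k (φ i) r)) *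
          (u r * star (u' r')) := by
        refine Finset.sum_congr rfl fun i _ => ?_
        simp only [tensorPowInner, star_sum, star_mul', star_star]
        rw [Finset.sum_mul_sum, Finset.sum_comm, Finset.mul_sum]
        refine Finset.sum_congr rfl fun r' _ => ?_
        rw [Finset.mul_sum]
        exact Finset.sum_congr rfl fun r _ => by ring
    _ = ∑ r', ∑ r, κ * permCount r' r * (u r * star (u' r')) := by
        rw [Finset.sum_comm]
        refine Finset.sum_congr rfl fun r' _ => ?_
        rw [Finset.sum_comm]
        refine Finset.sum_congr rfl fun r _ => ?_
        rw [← Finset.sum_mul, h]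
    _ = ∑ r', κ * star (u' r') * ∑ r, permCount r' r * u r := by
        refine Finset.sum_congr rfl fun r' _ => ?_
        rw [Finset.mul_sum]
        exact Finset.sum_congr rfl fun r _ => by ring
    _ = _ := by
        simp only [sum_permCount_mul u hu]
        rw [Finset.mul_sum]
        exact Finset.sum_congr rfl fun r _ => by ring

end Wick

/-! ### Entropy bounds from the overlap with a product vector. -/

section Entropy

variable {ι : Type*} [Fintype ι]

theorem star_dotProduct_self_eq (v : ι → ℂ) :
    star v ⬝ᵥ v = ((∑ i, ‖v i‖ ^ 2 : ℝ) : ℂ) := by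
  simp only [dotProduct, Pi.star_apply, Complex.star_def, Complex.conj_mul']
  push_cast
  rfl

theorem trace_ketbra (v : ι → ℂ) : (ketbra v).trace = ((∑ i, ‖v i‖ ^ 2 : ℝ) : ℂ) := by
  rw [ketbra, Matrix.trace_vecMulVec, dotProduct_comm, star_dotProduct_self_eq]

theorem trace_reduceFst {α β : Type*} [Fintype α] [Fintype β] (M : Matrix (α × β) (α × β) ℂ) :
    (reduceFst M).trace = M.trace := by
  simp [Matrix.trace, reduceFst, Fintype.sum_prod_type]

theorem posSemidef_reduceFst_ketbra {α β : Type*} [Fintype α] [Fintype β] (u : α × β → ℂ) :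
    (reduceFst (ketbra u)).PosSemidef := by
  have : reduceFst (ketbra u) = ∑ b, ketbra fun a => u (a, b) := by
    ext i j
    simp [reduceFst, ketbra, Matrix.vecMulVec_apply, Matrix.sum_apply]
  rw [this]
  exact Matrix.posSemidef_sum _ fun b _ => Matrix.posSemidef_vecMulVec_self_star _

theorem isDensity_reduceFst_ketbra {α β : Type*} [Fintype α] [Fintype β] {u : α × β → ℂ}
    (hu : IsUnitVec u) : IsDensity (reduceFst (ketbra u)) := by
  refine ⟨posSemidef_reduceFst_ketbra u, ?_⟩
  rw [trace_reduceFst, trace_ketbra, hu]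
  simp

/-- Gibbs' inequality. -/
theorem sum_negMulLog_le {l μ : ι → ℝ} (hl : ∀ i, 0 ≤ l i) (hμ : ∀ i, 0 < μ i)
    (h : ∑ i, μ i ≤ ∑ i, l i) :
    ∑ i, Real.negMulLog (l i) ≤ ∑ i, -(l i * Real.log (μ i)) := by
  have key : ∀ i, Real.negMulLog (l i) ≤ -(l i * Real.log (μ i)) + (μ i - l i) := by
    intro i
    rcases (hl i).eq_or_lt with h0 | h0
    · rw [← h0]; simpa using (hμ i).le
    · have h1 := Real.log_le_sub_one_of_pos (div_pos (hμ i) h0)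
      rw [Real.log_div (hμ i).ne' h0.ne'] at h1
      have h2 := mul_le_mul_of_nonneg_left h1 h0.le
      have h3 : l i * (μ i / l i - 1) = μ i - l i := by field_simp
      rw [h3] at h2
      rw [Real.negMulLog]
      linarith
  have := Finset.sum_le_sum fun i (_ : i ∈ Finset.univ) => key i
  rw [Finset.sum_add_distrib, Finset.sum_sub_distrib] at this
  linarith

variable [DecidableEq ι]

theorem entropy_eq_sum_negMulLog {τ : Matrix ι ι ℂ} (hτ : τ.IsHermitian) :
    entropy τ = ∑ i, Real.negMulLog (hτ.eigenvalues i) := by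
  have h1 : τ * cfc Real.log τ =
      Unitary.conjStarAlgAut ℂ _ hτ.eigenvectorUnitary
        (Matrix.diagonal fun i => ((hτ.eigenvalues i * Real.log (hτ.eigenvalues i) : ℝ) : ℂ)) := by
    rw [hτ.cfc_eq, Matrix.IsHermitian.cfc]
    conv_lhs => enter [1]; rw [hτ.spectral_theorem]
    rw [← map_mul, Matrix.diagonal_mul_diagonal]
    congr 2
    funext i
    simp
  rw [entropy, h1, Unitary.conjStarAlgAut_apply, Matrix.trace_mul_cycle]
  rw [Unitary.coe_star_mul_self, one_mul, Matrix.trace_diagonal]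
  rw [← Complex.ofReal_sum, Complex.ofReal_re, ← Finset.sum_neg_distrib]
  simp [Real.negMulLog]

theorem IsDensity.sum_eigenvalues {τ : Matrix ι ι ℂ} (hτ : IsDensity τ) :
    ∑ i, hτ.1.1.eigenvalues i = 1 := by
  have := hτ.1.1.trace_eq_sum_eigenvalues
  have h := hτ.2.symm.trans this
  exact Complex.ofReal_injective (by simpa using h.symm)

theorem IsDensity.entropy_nonneg {τ : Matrix ι ι ℂ} (hτ : IsDensity τ) : 0 ≤ entropy τ := by
  rw [entropy_eq_sum_negMulLog hτ.1.1]
  refine Finset.sum_nonneg fun i _ => Real.negMulLog_nonneg (hτ.1.eigenvalues_nonneg i) ?_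
  rw [← hτ.sum_eigenvalues]
  exact Finset.single_le_sum (fun j _ => hτ.1.eigenvalues_nonneg j) (Finset.mem_univ i)

/-- An affine bound for the Shannon entropy in terms of one of the probabilities. -/
theorem sum_negMulLog_le_affine {l : ι → ℝ} (hl : ∀ i, 0 ≤ l i) (hl1 : ∑ i, l i = 1)
    (hd : 2 ≤ Fintype.card ι) (k : ι) :
    ∑ i, Real.negMulLog (l i) ≤
      Real.log (Fintype.card ι / (Fintype.card ι - 1)) +
        Real.log (Fintype.card ι * (Fintype.card ι - 1)) * (1 - l k) := by
  set d : ℝ := (Fintype.card ι : ℝ) with hdef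
  have hd2 : (2 : ℝ) ≤ d := by rw [hdef]; exact_mod_cast hd
  have hd1 : 0 < d - 1 := by linarith
  have hd0 : 0 < d := by linarith
  -- Reference distribution for Gibbs' inequality: mass `1 / d` spread evenly off `k`. A fixed
  -- reference makes the bound affine in `l k`, hence stable under averaging.
  let μ : ι → ℝ := fun i => if i = k then (d - 1) / d else 1 / (d * (d - 1))
  have hμ : ∀ i, 0 < μ i := fun i => by
    simp only [μ]; split_ifs <;> positivity
  have hcard : ((Finset.univ.erase k).card : ℝ) = d - 1 := by
    rw [Finset.card_erase_of_mem (Finset.mem_univ k), Finset.card_univ,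
      Nat.cast_sub (by omega)]
    simp [hdef]
  have hsum : ∑ i, μ i = 1 := by
    rw [← Finset.add_sum_erase _ _ (Finset.mem_univ k), Finset.sum_congr rfl fun i hi => by
      rw [show μ i = 1 / (d * (d - 1)) from if_neg (Finset.ne_of_mem_erase hi)],
      Finset.sum_const, nsmul_eq_mul, hcard]
    simp only [μ, if_true]
    field_simp
    ring
  refine (sum_negMulLog_le hl hμ (by rw [hsum, hl1])).trans ?_
  have hrest : ∑ i ∈ Finset.univ.erase k, l i = 1 - l k := by
    rw [← hl1, ← Finset.add_sum_erase _ _ (Finset.mem_univ k)]; ring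
  rw [← Finset.add_sum_erase _ _ (Finset.mem_univ k), Finset.sum_congr rfl fun i hi => by
    rw [show μ i = 1 / (d * (d - 1)) from if_neg (Finset.ne_of_mem_erase hi)],
    Finset.sum_neg_distrib, ← Finset.sum_mul, hrest]
  have e1 : Real.log (μ k) = -Real.log (d / (d - 1)) := by
    rw [← Real.log_inv, inv_div]; simp [μ]
  have e2 : Real.log (1 / (d * (d - 1))) = -Real.log (d * (d - 1)) := by
    rw [one_div, Real.log_inv]
  rw [e1, e2]
  have h1 : l k ≤ 1 := by
    rw [← hl1]; exact Finset.single_le_sum (fun j _ => hl j) (Finset.mem_univ k)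
  have h2 : 0 ≤ Real.log (d / (d - 1)) :=
    Real.log_nonneg (by rw [le_div_iff₀ hd1]; linarith)
  nlinarith

/-- Rayleigh's bound on the quadratic form by the largest eigenvalue. -/
theorem re_star_dotProduct_mulVec_le {τ : Matrix ι ι ℂ} (hτ : τ.IsHermitian) {k : ι}
    (hk : ∀ i, hτ.eigenvalues i ≤ hτ.eigenvalues k) (φ : ι → ℂ) :
    (star φ ⬝ᵥ τ.mulVec φ).re ≤ hτ.eigenvalues k * ∑ i, ‖φ i‖ ^ 2 := by
  set U : Matrix ι ι ℂ := (hτ.eigenvectorUnitary : Matrix ι ι ℂ) with hU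
  set ψ : ι → ℂ := (star U).mulVec φ with hψ
  have hstar : star ψ = Matrix.vecMul (star φ) U := by
    rw [hψ, Matrix.star_mulVec, Matrix.star_eq_conjTranspose, Matrix.conjTranspose_conjTranspose]
  have h1 : star φ ⬝ᵥ τ.mulVec φ = ((∑ i, hτ.eigenvalues i * ‖ψ i‖ ^ 2 : ℝ) : ℂ) := by
    conv_lhs => rw [hτ.spectral_theorem]
    rw [Unitary.conjStarAlgAut_apply, ← Matrix.mulVec_mulVec, ← Matrix.mulVec_mulVec,
      Matrix.dotProduct_mulVec, ← hU, ← hstar, ← hψ]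
    simp only [dotProduct, Matrix.mulVec_diagonal, Pi.star_apply, Complex.star_def]
    push_cast
    refine Finset.sum_congr rfl fun i _ => ?_
    rw [← Complex.conj_mul']
    simp
    ring
  have h2 : ∑ i, ‖ψ i‖ ^ 2 = ∑ i, ‖φ i‖ ^ 2 := by
    have : star ψ ⬝ᵥ ψ = star φ ⬝ᵥ φ := by
      rw [hstar, hψ, ← Matrix.dotProduct_mulVec, Matrix.mulVec_mulVec, hU,
        Unitary.mul_star_self_of_mem hτ.eigenvectorUnitary.2, Matrix.one_mulVec]
    rw [star_dotProduct_self_eq, star_dotProduct_self_eq] at this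
    exact_mod_cast this
  rw [h1, Complex.ofReal_re, ← h2, Finset.mul_sum]
  exact Finset.sum_le_sum fun i _ => mul_le_mul_of_nonneg_right (hk i) (by positivity)

/-- The entropy of a state whose overlap with the direction `φ` is large is small. -/
theorem IsDensity.entropy_le {τ : Matrix ι ι ℂ} (hτ : IsDensity τ) (hd : 2 ≤ Fintype.card ι)
    (φ : ι → ℂ) :
    entropy τ ≤ Real.log (Fintype.card ι / (Fintype.card ι - 1)) +
      Real.log (Fintype.card ι * (Fintype.card ι - 1)) *
        (1 - (star φ ⬝ᵥ τ.mulVec φ).re / ∑ i, ‖φ i‖ ^ 2) := by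
  have : Nonempty ι := Fintype.card_pos_iff.1 (by omega)
  obtain ⟨k, hk⟩ := Finite.exists_max hτ.1.1.eigenvalues
  rw [entropy_eq_sum_negMulLog hτ.1.1]
  refine (sum_negMulLog_le_affine hτ.1.eigenvalues_nonneg hτ.sum_eigenvalues hd k).trans ?_
  have hd2 : (2 : ℝ) ≤ Fintype.card ι := by exact_mod_cast hd
  have h1 : 0 ≤ Real.log (Fintype.card ι * (Fintype.card ι - 1)) :=
    Real.log_nonneg (by nlinarith)
  have h2 : (star φ ⬝ᵥ τ.mulVec φ).re / ∑ i, ‖φ i‖ ^ 2 ≤ hτ.1.1.eigenvalues k :=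
    div_le_of_le_mul₀ (by positivity) (hτ.1.eigenvalues_nonneg k)
      (re_star_dotProduct_mulVec_le hτ.1.1 hk φ)
  gcongr

/-- The entanglement of a pure state that is close to the product vector `φ ⊗ φ` is small. -/
theorem entropy_reduceFst_ketbra_le (hd : 2 ≤ Fintype.card ι) {u : ι × ι → ℂ} (hu : IsUnitVec u)
    (φ : ι → ℂ) :
    entropy (reduceFst (ketbra u)) ≤ Real.log (Fintype.card ι / (Fintype.card ι - 1)) +
      Real.log (Fintype.card ι * (Fintype.card ι - 1)) *
        (1 - ‖∑ p : ι × ι, star (φ p.1 * φ p.2) * u p‖ ^ 2 / (∑ i, ‖φ i‖ ^ 2) ^ 2) := by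
  refine ((isDensity_reduceFst_ketbra hu).entropy_le hd φ).trans ?_
  have hd2 : (2 : ℝ) ≤ Fintype.card ι := by exact_mod_cast hd
  have h1 : 0 ≤ Real.log (Fintype.card ι * (Fintype.card ι - 1)) :=
    Real.log_nonneg (by nlinarith)
  set s : ℝ := ∑ i, ‖φ i‖ ^ 2 with hs
  have hs0 : 0 ≤ s := by positivity
  have hF : (star φ ⬝ᵥ (reduceFst (ketbra u)).mulVec φ).re =
      ∑ b, ‖∑ i, star (φ i) * u (i, b)‖ ^ 2 := by
    have : star φ ⬝ᵥ (reduceFst (ketbra u)).mulVec φ =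
        ((∑ b, ‖∑ i, star (φ i) * u (i, b)‖ ^ 2 : ℝ) : ℂ) := by
      push_cast
      simp only [← Complex.mul_conj', map_sum, Finset.sum_mul_sum]
      simp only [dotProduct, Matrix.mulVec, reduceFst, ketbra, Matrix.of_apply,
        Matrix.vecMulVec_apply, Finset.sum_mul, Finset.mul_sum, Pi.star_apply]
      rw [Finset.sum_comm' (t' := Finset.univ) (s' := fun _ => Finset.univ) (by simp)]
      rw [Finset.sum_comm]
      conv_rhs => rw [Finset.sum_comm]
      refine Finset.sum_congr rfl fun i _ => ?_
      rw [Finset.sum_comm]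
      refine Finset.sum_congr rfl fun b _ => ?_
      refine Finset.sum_congr rfl fun j _ => ?_
      simp
      ring
    rw [this, Complex.ofReal_re]
  -- Cauchy–Schwarz in the second factor: contracting only the first factor with `φ` loses no
  -- overlap.
  have hCS : ‖∑ p : ι × ι, star (φ p.1 * φ p.2) * u p‖ ^ 2 ≤
      s * ∑ b, ‖∑ i, star (φ i) * u (i, b)‖ ^ 2 := by
    have e : ∑ p : ι × ι, star (φ p.1 * φ p.2) * u p =
        ∑ b, star (φ b) * ∑ i, star (φ i) * u (i, b) := by
      rw [Fintype.sum_prod_type_right]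
      refine Finset.sum_congr rfl fun b _ => ?_
      rw [Finset.mul_sum]
      exact Finset.sum_congr rfl fun i _ => by rw [star_mul']; ring
    rw [e]
    calc ‖∑ b, star (φ b) * ∑ i, star (φ i) * u (i, b)‖ ^ 2
        ≤ (∑ b, ‖φ b‖ * ‖∑ i, star (φ i) * u (i, b)‖) ^ 2 := by
          gcongr
          refine (norm_sum_le _ _).trans_eq ?_
          simp only [norm_mul, norm_star]
      _ ≤ _ := Finset.sum_mul_sq_le_sq_mul_sq _ _ _
  rw [hF]
  have h3 : ‖∑ p : ι × ι, star (φ p.1 * φ p.2) * u p‖ ^ 2 / s ^ 2 ≤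
      (∑ b, ‖∑ i, star (φ i) * u (i, b)‖ ^ 2) / s := by
    rcases hs0.eq_or_lt with h0 | h0
    · simp [← h0]
    · rw [div_le_div_iff₀ (by positivity) h0]
      nlinarith
  gcongr

end Entropy

/-! ### Entanglement of formation from unnormalized decompositions. -/

section Formation

variable {α β : Type*} [Fintype α] [Fintype β] [DecidableEq α]

theorem eof_le_of_isPureEnsemble {σ : Matrix (α × β) (α × β) ℂ} {N : ℕ} {p : Fin N → ℝ}
    {φ : Fin N → α × β → ℂ} (h : IsPureEnsemble σ p φ) :
    eof σ ≤ ∑ i, p i * entropy (reduceFst (ketbra (φ i))) := by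
  refine csInf_le ⟨0, ?_⟩ ⟨N, p, φ, h, rfl⟩
  rintro _ ⟨N, p, φ, h, rfl⟩
  exact Finset.sum_nonneg fun i _ =>
    mul_nonneg (h.nonneg i) (isDensity_reduceFst_ketbra (h.unit i)).entropy_nonneg

/-- The entanglement of formation is at most the average entanglement of any finite decomposition
into unnormalized vectors. -/
theorem eof_le_sum {J : Type*} [Fintype J] {σ : Matrix (α × β) (α × β) ℂ} (hσ : σ.trace = 1)
    (ψ : J → α × β → ℂ) (hψ : ∑ j, ketbra (ψ j) = σ) (g : J → ℝ)
    (hg : ∀ j (s : ℝ) (u : α × β → ℂ), IsUnitVec u → ψ j = (s : ℂ) • u →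
      s ^ 2 * entropy (reduceFst (ketbra u)) ≤ g j) :
    eof σ ≤ ∑ j, g j := by
  classical
  have hne : Nonempty (α × β) := by
    by_contra h
    rw [not_nonempty_iff] at h
    simp [Matrix.trace] at hσ
  have hex : ∀ v : α × β → ℂ, ∃ (s : ℝ) (u : α × β → ℂ), IsUnitVec u ∧ v = (s : ℂ) • u := by
    intro v
    rcases eq_or_ne v 0 with rfl | hv
    · refine ⟨0, Pi.single hne.some 1, ?_, by simp⟩
      rw [IsUnitVec, Finset.sum_eq_single hne.some] <;> simp +contextual
    · have hpos : 0 < ∑ i, ‖v i‖ ^ 2 := by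
        obtain ⟨i, hi⟩ := Function.ne_iff.1 hv
        exact Finset.sum_pos' (fun _ _ => by positivity)
          ⟨i, Finset.mem_univ i, by have := norm_pos_iff.2 hi; positivity⟩
      have hs := Real.sqrt_pos.2 hpos
      refine ⟨Real.sqrt (∑ i, ‖v i‖ ^ 2), ((Real.sqrt (∑ i, ‖v i‖ ^ 2))⁻¹ : ℂ) • v, ?_, ?_⟩
      · simp only [IsUnitVec, Pi.smul_apply, norm_smul, mul_pow, ← Finset.mul_sum]
        rw [norm_inv, Complex.norm_real, Real.norm_of_nonneg hs.le, inv_pow, Real.sq_sqrt hpos.le,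
          inv_mul_cancel₀ hpos.ne']
      · rw [smul_smul, mul_inv_cancel₀ (by exact_mod_cast hs.ne'), one_smul]
  choose s u hu hsu using fun j => hex (ψ j)
  have hket : ∀ j, ketbra (ψ j) = ((s j ^ 2 : ℝ) : ℂ) • ketbra (u j) := by
    intro j
    rw [hsu j]
    ext a b
    simp [ketbra, Matrix.vecMulVec_apply]
    ring
  let e := (Fintype.equivFin J).symm
  have hens : IsPureEnsemble σ (fun i => s (e i) ^ 2) (fun i => u (e i)) := by
    refine ⟨fun i => sq_nonneg _, ?_, fun i => hu _, ?_⟩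
    · rw [e.sum_comp fun j => s j ^ 2]
      have h1 := hσ
      rw [← hψ, Matrix.trace_sum] at h1
      have h2 : ∀ j, (ketbra (ψ j)).trace = ((s j ^ 2 : ℝ) : ℂ) := by
        intro j
        rw [hket, Matrix.trace_smul, trace_ketbra, hu j]
        simp
      simp only [h2] at h1
      exact_mod_cast h1
    · rw [e.sum_comp fun j => ((s j ^ 2 : ℝ) : ℂ) • ketbra (u j), ← hψ]
      exact Finset.sum_congr rfl fun j _ => (hket j).symm
  refine (eof_le_of_isPureEnsemble hens).trans ?_
  rw [e.sum_comp fun j => s j ^ 2 * entropy (reduceFst (ketbra (u j)))]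
  exact Finset.sum_le_sum fun j _ => hg j _ _ (hu j) (hsu j)

/-- A bound on the entanglement of formation in terms of the overlaps of a decomposition with
product vectors. -/
theorem eof_le_of_overlap {ι J : Type*} [Fintype ι] [DecidableEq ι] [Fintype J]
    {σ : Matrix (ι × ι) (ι × ι) ℂ} (hσ : σ.trace = 1) (hd : 2 ≤ Fintype.card ι)
    (ψ : J → ι × ι → ℂ) (hψ : ∑ j, ketbra (ψ j) = σ) (φ : J → ι → ℂ) {F : ℝ}
    (hF : F ≤ ∑ j, ‖∑ p : ι × ι, star (φ j p.1 * φ j p.2) * ψ j p‖ ^ 2 /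
      (∑ i, ‖φ j i‖ ^ 2) ^ 2) :
    eof σ ≤ Real.log (Fintype.card ι / (Fintype.card ι - 1)) +
      Real.log (Fintype.card ι * (Fintype.card ι - 1)) * (1 - F) := by
  set c := Real.log (Fintype.card ι / (Fintype.card ι - 1))
  set L := Real.log (Fintype.card ι * (Fintype.card ι - 1)) with hL
  have hL0 : 0 ≤ L := by
    have hd2 : (2 : ℝ) ≤ Fintype.card ι := by exact_mod_cast hd
    exact Real.log_nonneg (by nlinarith)
  have htr : ∑ j, ∑ p, ‖ψ j p‖ ^ 2 = 1 := by
    rw [← hψ, Matrix.trace_sum] at hσ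
    simp only [trace_ketbra] at hσ
    exact_mod_cast hσ
  -- The affine entropy bound multiplied by `s ^ 2` becomes homogeneous quadratic in `ψ j`, so no
  -- normalization remains.
  refine (eof_le_sum hσ ψ hψ (fun j => (c + L) * (∑ p, ‖ψ j p‖ ^ 2) -
    L * (‖∑ p : ι × ι, star (φ j p.1 * φ j p.2) * ψ j p‖ ^ 2 / (∑ i, ‖φ j i‖ ^ 2) ^ 2))
    fun j s u hu hsu => ?_).trans ?_
  · have h1 := mul_le_mul_of_nonneg_left (entropy_reduceFst_ketbra_le hd hu (φ j)) (sq_nonneg s)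
    refine h1.trans_eq ?_
    have e1 : ∑ p, ‖ψ j p‖ ^ 2 = s ^ 2 := by
      rw [hsu]
      simp only [Pi.smul_apply, norm_smul, mul_pow, ← Finset.mul_sum, Complex.norm_real,
        Real.norm_eq_abs, sq_abs]
      rw [hu, mul_one]
    have e2 : ‖∑ p : ι × ι, star (φ j p.1 * φ j p.2) * ψ j p‖ ^ 2 =
        s ^ 2 * ‖∑ p : ι × ι, star (φ j p.1 * φ j p.2) * u p‖ ^ 2 := by
      have : ∑ p : ι × ι, star (φ j p.1 * φ j p.2) * ψ j p =
          (s : ℂ) * ∑ p : ι × ι, star (φ j p.1 * φ j p.2) * u p := by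
        rw [hsu, Finset.mul_sum]
        exact Finset.sum_congr rfl fun p _ => by
          simp only [Pi.smul_apply, smul_eq_mul]; ring
      rw [this, norm_mul, mul_pow, Complex.norm_real, Real.norm_eq_abs, sq_abs]
    rw [e1, e2]
    ring
  · rw [Finset.sum_sub_distrib, ← Finset.mul_sum, ← Finset.mul_sum, htr]
    nlinarith

end Formation

/-! ### Symmetric vectors and splitting off two sites. -/

section Sites

variable {α : Type*}

theorem tensorPow_comp_perm {k : ℕ} (φ : α → ℂ) (π : Equiv.Perm (Fin k)) (r : Fin k → α) :
    tensorPow k φ (r ∘ π) = tensorPow k φ r :=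
  Equiv.prod_comp π fun t => φ (r t)

theorem tensorPow_joinSites {k : ℕ} (φ : α → ℂ) (p : α × α) (r : Fin k → α) :
    tensorPow (k + 2) φ (joinSites p r) = φ p.1 * φ p.2 * tensorPow k φ r := by
  simp only [tensorPow]
  rw [Fin.prod_univ_succ, Fin.prod_univ_succ, ← mul_assoc]
  rfl

theorem apply_comp_perm_of_mem_symSubspace {m : ℕ} {v : (Fin m → α) → ℂ}
    (hv : v ∈ symSubspace α m) (π : Equiv.Perm (Fin m)) (r : Fin m → α) : v (r ∘ π) = v r := by
  induction hv using Submodule.span_induction with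
  | mem x hx => obtain ⟨φ, rfl⟩ := hx; exact tensorPow_comp_perm φ π r
  | zero => rfl
  | add x y _ _ hx hy => simp only [Pi.add_apply, hx, hy]
  | smul c x _ hx => simp only [Pi.smul_apply, hx]

theorem apply_joinSites_comp_perm_of_mem_symSubspace {k : ℕ} {v : (Fin (k + 2) → α) → ℂ}
    (hv : v ∈ symSubspace α (k + 2)) (p : α × α) (π : Equiv.Perm (Fin k)) (r : Fin k → α) :
    v (joinSites p (r ∘ π : Fin k → α)) = v (joinSites p r) := by
  induction hv using Submodule.span_induction with
  | mem x hx =>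
    obtain ⟨φ, rfl⟩ := hx
    exact (tensorPow_joinSites φ p (r ∘ π)).trans
      ((congrArg _ (tensorPow_comp_perm φ π r)).trans (tensorPow_joinSites φ p r).symm)
  | zero => rfl
  | add x y _ _ hx hy => simp only [Pi.add_apply, hx, hy]
  | smul c x _ hx => simp only [Pi.smul_apply, hx]

/-- Splitting off the first two sites. -/
def joinSitesEquiv (α : Type*) (k : ℕ) : (α × α) × (Fin k → α) ≃ (Fin (k + 2) → α) where
  toFun x := joinSites x.1 x.2
  invFun x := ((x 0, x 1), fun t => x t.succ.succ)
  left_inv x := rfl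
  right_inv x := by
    funext t
    refine Fin.cases rfl (fun t => Fin.cases rfl (fun t => rfl) t) t

theorem sum_joinSites [Fintype α] {M : Type*} [AddCommMonoid M] {k : ℕ}
    (f : (Fin (k + 2) → α) → M) :
    ∑ p : α × α, ∑ r : Fin k → α, f (joinSites p r) = ∑ x, f x := by
  rw [← (joinSitesEquiv α k).sum_comp f]
  exact (Fintype.sum_prod_type fun x => f (joinSitesEquiv α k x)).symm

theorem trace_reduceTwoSites [Fintype α] {k : ℕ}
    (ρ : Matrix (Fin (k + 2) → α) (Fin (k + 2) → α) ℂ) :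
    (reduceTwoSites ρ).trace = ρ.trace :=
  sum_joinSites fun x => ρ x x

/-- A symmetric state is a sum of rank one operators of symmetric vectors. -/
theorem IsSymState.exists_decomposition [Fintype α] [DecidableEq α] {m : ℕ}
    {ρ : Matrix (Fin m → α) (Fin m → α) ℂ} (hρ : IsSymState ρ) :
    ∃ v : (Fin m → α) → (Fin m → α) → ℂ,
      (∀ κ, v κ ∈ symSubspace α m) ∧ ∑ κ, ketbra (v κ) = ρ := by
  have hH := hρ.1.1.1
  refine ⟨fun κ => (Real.sqrt (hH.eigenvalues κ) : ℂ) • ⇑(hH.eigenvectorBasis κ),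
    fun κ => ?_, ?_⟩
  -- An eigenvector of nonzero eigenvalue lies in the range of `ρ`, hence is symmetric; the others
  -- are scaled to zero.
  · rcases eq_or_ne (hH.eigenvalues κ) 0 with h0 | h0
    · simp [h0]
    · refine Submodule.smul_mem _ _ ?_
      have h1 := hρ.2 ((hH.eigenvalues κ : ℂ)⁻¹ • ⇑(hH.eigenvectorBasis κ))
      rw [Matrix.mulVec_smul, hH.mulVec_eigenvectorBasis] at h1
      convert h1 using 1
      funext x
      simp only [Pi.smul_apply, Complex.real_smul, smul_eq_mul]
      rw [inv_mul_cancel_left₀ (by exact_mod_cast h0)]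
  · conv_rhs => rw [hH.spectral_theorem]
    ext x y
    rw [Unitary.conjStarAlgAut_apply, Matrix.mul_apply]
    simp only [Matrix.mul_diagonal, Matrix.sum_apply, ketbra, Matrix.vecMulVec_apply,
      Pi.star_apply, Pi.smul_apply, smul_eq_mul, star_mul', Matrix.star_apply,
      Matrix.IsHermitian.eigenvectorUnitary_apply, Function.comp_apply]
    refine Finset.sum_congr rfl fun κ _ => ?_
    have h2 : ((Real.sqrt (hH.eigenvalues κ) : ℂ)) * (Real.sqrt (hH.eigenvalues κ) : ℂ) =
        (hH.eigenvalues κ : ℂ) := by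
      rw [← Complex.ofReal_mul, Real.mul_self_sqrt (hρ.1.1.eigenvalues_nonneg κ)]
    simp only [Complex.star_def, Complex.conj_ofReal, Complex.coe_algebraMap, RCLike.ofReal]
    rw [← h2]
    ring

end Sites

/-! ### The monogamy bound and its asymptotics. -/

/-- Tangent of the convex function `s⁻²` at `R`. It replaces a non-polynomial weight by one whose
average is a Gaussian moment. -/
theorem tangent_le_inv_sq {R s : ℝ} (hR : 0 < R) (hs : 0 < s) :
    3 / R ^ 2 - 2 * s / R ^ 3 ≤ 1 / s ^ 2 := by
  have : 1 / s ^ 2 - (3 / R ^ 2 - 2 * s / R ^ 3) = (R - s) ^ 2 * (R + 2 * s) / (s ^ 2 * R ^ 3) := by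
    field_simp
    ring
  have h2 : 0 ≤ (R - s) ^ 2 * (R + 2 * s) / (s ^ 2 * R ^ 3) := by positivity
  linarith

/-- Monogamy bound: two sites of a symmetric state of `m` sites have little entanglement. -/
theorem eof_reduceTwoSites_le {α : Type*} [Fintype α] [DecidableEq α] {m : ℕ} (hm : 2 ≤ m)
    (hd : 2 ≤ Fintype.card α) {ρ : Matrix (Fin m → α) (Fin m → α) ℂ} (hρ : IsSymState ρ) :
    eof (reduceTwoSites ρ) ≤ Real.log (Fintype.card α / (Fintype.card α - 1)) +
      Real.log (Fintype.card α * (Fintype.card α - 1)) *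
        (1 - (m * (m - 1)) / (m + Fintype.card α) ^ 2) := by
  obtain ⟨k, rfl⟩ := Nat.exists_eq_add_of_le' hm
  obtain ⟨v, hv, hvρ⟩ := hρ.exists_decomposition
  -- The moments of `m = k + 2` sites weighted by `‖φ‖²` have degree `k + 3`.
  obtain ⟨I, _, w, φ, hw, hmom, hmom'⟩ := exists_wick_frame α (k + 3)
  have hk0 : (0 : ℝ) < k.factorial := by exact_mod_cast Nat.factorial_pos k
  have hk0' : (k.factorial : ℂ) ≠ 0 := by exact_mod_cast (Nat.factorial_pos k).ne'
  have hsqrt : ∀ i, (Real.sqrt (w i / k.factorial) : ℂ) * (Real.sqrt (w i / k.factorial) : ℂ) =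
      w i / k.factorial := by
    intro i
    rw [← Complex.ofReal_mul, Real.mul_self_sqrt (div_nonneg (hw i) hk0.le)]
    push_cast
    rfl
  -- The unnormalized state of the first two sites after outcome `φ j.1` on the other `k`; dividing
  -- by `k!` makes the measurement complete on symmetric vectors.
  let ψ : I × (Fin (k + 2) → α) → α × α → ℂ := fun j p =>
    (Real.sqrt (w j.1 / k.factorial) : ℂ) *
      tensorPowInner (φ j.1) fun r : Fin k → α => v j.2 (joinSites p r)
  refine eof_le_of_overlap ((trace_reduceTwoSites ρ).trans hρ.1.2) hd ψ ?_ (fun j => φ j.1) ?_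
  · ext p q
    have h1 : ∀ κ, ∑ i, ψ (i, κ) p * star (ψ (i, κ) q) =
        ∑ r : Fin k → α, v κ (joinSites p r) * star (v κ (joinSites q r)) := by
      intro κ
      have h2 := sum_tensorPowInner_mul_star w φ 1
        (fun r r' => by rw [hmom k (by omega), one_mul])
        (fun r : Fin k → α => v κ (joinSites p r)) (fun r : Fin k → α => v κ (joinSites q r))
        (fun π r => apply_joinSites_comp_perm_of_mem_symSubspace (hv κ) p π r)
      rw [one_mul] at h2
      rw [← mul_right_inj' hk0', ← h2, Finset.mul_sum]
      refine Finset.sum_congr rfl fun i _ => ?_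
      simp only [ψ, star_mul', Complex.star_def, Complex.conj_ofReal]
      have h3 : (w i : ℂ) = k.factorial * ((Real.sqrt (w i / k.factorial) : ℂ) *
          (Real.sqrt (w i / k.factorial) : ℂ)) := by
        rw [hsqrt]; field_simp
      rw [h3]
      ring
    have h4 : (∑ j, ketbra (ψ j)) p q = ∑ κ, ∑ i, ψ (i, κ) p * star (ψ (i, κ) q) := by
      rw [Matrix.sum_apply, Fintype.sum_prod_type_right]
      rfl
    rw [h4]
    simp only [h1]
    rw [Finset.sum_comm, ← hvρ]
    simp only [reduceTwoSites, Matrix.of_apply, Matrix.sum_apply, ketbra, Matrix.vecMulVec_apply,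
      Pi.star_apply]
    rfl
  -- `R = m + d` is the mean of `‖φ‖²` under the weights `w i * ‖tensorPowInner (φ i) (v κ)‖ ^ 2`
  -- (compare `hA` and `hB`), hence the best tangent point. The tangent then averages to `3 / R ^ 2
  -- - 2 / R ^ 2 = 1 / R ^ 2`, and `(k + 2)! / k! = m (m - 1)`.
  · set R : ℝ := ((k + 2 : ℕ) : ℝ) + Fintype.card α with hR
    have hR0 : 0 < R := by positivity
    have hov : ∀ i κ, ‖∑ p : α × α, star (φ i p.1 * φ i p.2) * ψ (i, κ) p‖ ^ 2 =
        w i / k.factorial * ‖tensorPowInner (φ i) (v κ)‖ ^ 2 := by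
      intro i κ
      have h1 : ∑ p : α × α, star (φ i p.1 * φ i p.2) * ψ (i, κ) p =
          (Real.sqrt (w i / k.factorial) : ℂ) * tensorPowInner (φ i) (v κ) := by
        simp only [tensorPowInner]
        rw [← sum_joinSites fun x => star (tensorPow (k + 2) (φ i) x) * v κ x, Finset.mul_sum]
        refine Finset.sum_congr rfl fun p _ => ?_
        simp only [ψ, tensorPowInner, tensorPow_joinSites, Finset.mul_sum, star_mul']
        exact Finset.sum_congr rfl fun r _ => by ring
      rw [h1, norm_mul, mul_pow, Complex.norm_real, Real.norm_of_nonneg (Real.sqrt_nonneg _),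
        Real.sq_sqrt (div_nonneg (hw i) hk0.le)]
    have hreal : ∀ (w' : I → ℝ) (c : ℝ) (κ), (∀ r r' : Fin (k + 2) → α,
        ∑ i, (w' i : ℂ) * (tensorPow (k + 2) (φ i) r * star (tensorPow (k + 2) (φ i) r')) =
          (c : ℂ) * permCount r r') →
        ∑ i, w' i * ‖tensorPowInner (φ i) (v κ)‖ ^ 2 =
          c * (k + 2).factorial * ∑ x, ‖v κ x‖ ^ 2 := by
      intro w' c κ h
      have h1 := sum_tensorPowInner_mul_star w' φ c h (v κ) (v κ)
        (apply_comp_perm_of_mem_symSubspace (hv κ))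
      simp only [Complex.star_def, Complex.mul_conj'] at h1
      exact_mod_cast h1
    have hA : ∀ κ, ∑ i, w i * ‖tensorPowInner (φ i) (v κ)‖ ^ 2 =
        (k + 2).factorial * ∑ x, ‖v κ x‖ ^ 2 := fun κ => by
      have := hreal w 1 κ fun r r' => by
        rw [hmom (k + 2) (by omega), Complex.ofReal_one, one_mul]
      rwa [one_mul] at this
    have hB : ∀ κ, ∑ i, (w i * ∑ a, ‖φ i a‖ ^ 2) * ‖tensorPowInner (φ i) (v κ)‖ ^ 2 =
        R * (k + 2).factorial * ∑ x, ‖v κ x‖ ^ 2 := fun κ =>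
      hreal (fun i => w i * ∑ a, ‖φ i a‖ ^ 2) R κ fun r r' => by
        rw [hmom' (k + 2) (by omega), hR]
        push_cast
        rfl
    have hnorm : ∑ κ, ∑ x, ‖v κ x‖ ^ 2 = 1 := by
      have h1 := hρ.1.2
      rw [← hvρ, Matrix.trace_sum] at h1
      simp only [trace_ketbra] at h1
      exact_mod_cast h1
    have hpt : ∀ i κ, (3 / R ^ 2 * (w i * ‖tensorPowInner (φ i) (v κ)‖ ^ 2) -
        2 / R ^ 3 * ((w i * ∑ a, ‖φ i a‖ ^ 2) * ‖tensorPowInner (φ i) (v κ)‖ ^ 2)) /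
          k.factorial ≤
        ‖∑ p : α × α, star (φ i p.1 * φ i p.2) * ψ (i, κ) p‖ ^ 2 /
          (∑ a, ‖φ i a‖ ^ 2) ^ 2 := by
      intro i κ
      rw [hov]
      set s := ∑ a, ‖φ i a‖ ^ 2 with hs
      have hs0 : 0 ≤ s := by positivity
      have hT : 0 ≤ w i / k.factorial * ‖tensorPowInner (φ i) (v κ)‖ ^ 2 :=
        mul_nonneg (div_nonneg (hw i) hk0.le) (by positivity)
      -- At `φ i = 0` the tangent bound is unavailable, but both sides vanish.
      rcases hs0.eq_or_lt with h0 | h0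
      · have h1 : φ i = 0 := by
          funext a
          have := (Finset.sum_eq_zero_iff_of_nonneg fun a _ => by positivity).1 (hs ▸ h0.symm) a
            (Finset.mem_univ a)
          simpa using this
        have h2 : tensorPowInner (φ i) (v κ) = 0 := by
          refine Finset.sum_eq_zero fun r _ => ?_
          rw [h1, tensorPow, Fin.prod_univ_succ]
          simp
        simp [h2]
      · have h1 := mul_le_mul_of_nonneg_left (tangent_le_inv_sq hR0 h0) hT
        refine le_trans (le_of_eq ?_) (h1.trans_eq ?_)
        · ring
        · ring
    refine le_trans (le_of_eq ?_) (Finset.sum_le_sum fun j _ => hpt j.1 j.2)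
    rw [Fintype.sum_prod_type_right]
    simp only [← Finset.sum_div, Finset.sum_sub_distrib, ← Finset.mul_sum, hA, hB, hnorm]
    rw [Nat.factorial_succ, Nat.factorial_succ]
    push_cast
    field_simp
    ring

/-- The bound for `m = d²` sites of dimension `d = 2 ^ n`. -/
theorem log_bound_le {n : ℕ} (hn : 1 ≤ n) :
    Real.log ((2 : ℝ) ^ n / (2 ^ n - 1)) + Real.log ((2 : ℝ) ^ n * (2 ^ n - 1)) *
      (1 - ((2 : ℝ) ^ (2 * n) * (2 ^ (2 * n) - 1)) / (2 ^ (2 * n) + 2 ^ n) ^ 2) ≤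
      6 * n / 2 ^ n := by
  have hlog : Real.log ((2 : ℝ) ^ n) ≤ n := by
    rw [Real.log_pow]
    have := Real.log_two_lt_d9
    have h0 : (0 : ℝ) ≤ n := by positivity
    nlinarith
  rw [mul_comm 2 n, pow_mul]
  have hd2 : (2 : ℝ) ≤ 2 ^ n := by
    simpa using pow_le_pow_right₀ (by norm_num : (1 : ℝ) ≤ 2) hn
  have hn1 : (1 : ℝ) ≤ n := by exact_mod_cast hn
  set d : ℝ := 2 ^ n
  have hd1 : 0 < d - 1 := by linarith
  have hd0 : 0 < d := by linarith
  -- With `m = d ^ 2` the fidelity bound simplifies to `(d - 1) / (d + 1)`.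
  have e1 : 1 - (d ^ 2 * (d ^ 2 - 1)) / (d ^ 2 + d) ^ 2 = 2 / (d + 1) := by
    have : d ^ 2 + d = d * (d + 1) := by ring
    rw [this]
    field_simp
    ring
  have h1 : Real.log (d / (d - 1)) ≤ 2 * n / d := by
    refine (Real.log_le_sub_one_of_pos (by positivity)).trans ?_
    have : d / (d - 1) - 1 = 1 / (d - 1) := by field_simp; ring
    rw [this, div_le_div_iff₀ hd1 hd0]
    nlinarith
  have h2 : Real.log (d * (d - 1)) ≤ 2 * n := by
    have h3 : Real.log (d * (d - 1)) ≤ Real.log (d ^ 2) :=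
      Real.log_le_log (by positivity) (by nlinarith)
    rw [Real.log_pow] at h3
    push_cast at h3
    linarith
  have h3 : Real.log (d * (d - 1)) * (2 / (d + 1)) ≤ 2 * n * (2 / d) := by
    have h4 : 2 / (d + 1) ≤ 2 / d := by gcongr; linarith
    exact mul_le_mul h2 h4 (by positivity) (by positivity)
  rw [e1]
  calc _ ≤ 2 * n / d + 2 * n * (2 / d) := add_le_add h1 h3
    _ = 6 * n / d := by ring

theorem isExponential_two_pow_div : IsExponential fun n => (2 : ℝ) ^ n / (6 * n) := by
  -- Any base strictly between `1` and `2` would do: `2 = (3 / 2) * (4 / 3)`, and `(4 / 3) ^ n`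
  -- eventually exceeds `6 * n`.
  refine ⟨3 / 2, 2, by norm_num, ?_⟩
  have h1 := tendsto_pow_const_div_const_pow_of_one_lt 1 (by norm_num : (1 : ℝ) < 4 / 3)
  filter_upwards [h1.eventually_le_const (by norm_num : (0 : ℝ) < 1 / 6), eventually_ge_atTop 1]
    with n h hn
  have hn1 : (1 : ℝ) ≤ n := by exact_mod_cast hn
  constructor
  · rw [pow_one, div_le_iff₀ (by positivity)] at h
    rw [le_div_iff₀ (by positivity)]
    have h2 : (2 : ℝ) ^ n = (3 / 2) ^ n * (4 / 3) ^ n := by rw [← mul_pow]; norm_num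
    rw [h2]
    gcongr
    linarith
  · exact div_le_self (by positivity) (by linarith)

end QuantumEnt

theorem mainTheorem1 :
    ∃ q : ℕ → ℝ,
      QuantumEnt.IsExponential q ∧
      (fun n : ℕ => 1 / q n) =O[atTop] (fun n : ℕ => (n : ℝ) * (2 : ℝ)⁻¹ ^ n) ∧
      ∀ n : ℕ, 1 ≤ n → 0 < q n ∧
        ∀ ρ : Matrix (Fin (2 ^ (2 * n)) → Fin (2 ^ n)) (Fin (2 ^ (2 * n)) → Fin (2 ^ n)) ℂ,
          QuantumEnt.IsSymState ρ →
            QuantumEnt.eof (QuantumEnt.reduceTwoSites ρ) ≤ 1 / q n := by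
  -- The reciprocal of the bound in `log_bound_le`. At `n = 0` division by zero gives `q 0 = 0`, so
  -- the estimate of `1 / q n` holds there too.
  refine ⟨fun n => (2 : ℝ) ^ n / (6 * n), QuantumEnt.isExponential_two_pow_div, ?_, ?_⟩
  · refine IsBigO.of_bound 6 (Eventually.of_forall fun n => le_of_eq ?_)
    rw [one_div_div, inv_pow, Real.norm_of_nonneg (by positivity),
      Real.norm_of_nonneg (by positivity)]
    ring
  · intro n hn
    have hn0 : (0 : ℝ) < n := by exact_mod_cast hn
    refine ⟨by positivity, fun ρ hρ => ?_⟩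
    have hd : 2 ≤ 2 ^ n := by simpa using Nat.pow_le_pow_right (by norm_num : 1 ≤ 2) hn
    have hm : 2 ≤ 2 ^ (2 * n) := hd.trans (Nat.pow_le_pow_right (by norm_num) (by omega))
    refine (QuantumEnt.eof_reduceTwoSites_le hm (by simpa using hd) hρ).trans ?_
    rw [one_div_div]
    simpa using QuantumEnt.log_bound_le hn
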